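/- Work in $\mathbb{R}^n$ with the lattice $\mathbb{Z}^n$. A full-dimensional polytope $P\subset\mathbb{R}^n$ is \emph{smooth} if exactly $n$ edges meet at each vertex, all edges have rational directions, and the primitive integer edge vectors at each vertex form a basis of $\mathbb{Z}^n$. It is a \emph{lattice polytope} if all its vertices lie in $\mathbb{Z}^n$. A lattice polytope with the origin in its interior is \emph{reflexive} if its dual $P^\vee=\operatorname{conv}\{u_F/b_F : F \text{ a facet of } P\}$ is also a lattice polytope, where $u_F\cdot x\le b_F$ is the inequality defining the facet $F$. A smooth lattice polytope $P$ is \emph{deeply smooth} if for every vertex $v$, with primitive edge vectors $u_1,\dots,u_n$, it contains the corner parallelepiped $\{v+\sum_i\lambda_i u_i : \lambda_i\in[0,1]\}$. It is \emph{deeply monotone} if moreover it is reflexive. Let $\mathcal{E}(P)=\mathbb{Z}^n\cap P\cap(-P)$. For a nonempty face $f$ of $P$ let $\operatorname{Star}(f)$ be the union of the facets containing $f$, $\operatorname{star}(f)$ the union of the faces of codimension two containing $f$, and $\operatorname{Star}^*(f)=\operatorname{Star}(f)\setminus\operatorname{star}(f)$. Theorem. Let $P\subset\mathbb{R}^n$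 be a deeply monotone polytope. Then: (i) If $u_1$ and $u_2$ are primitive edge vectors of $P$ at the same vertex, then $\mathcal{E}(P)$ contains $u_1$, $u_2$, and at least one of $u_1+u_2$ and $u_1-u_2$. (ii) $P$ satisfies the star Ewald condition: for every nonempty proper face $f$ of $P$ there is $\lambda\in\mathcal{E}(P)$ with $\lambda\in\operatorname{Star}^*(f)$ and $-\lambda\notin\operatorname{Star}(f)$. (iii) $P$ satisfies the strong Ewald condition: for every facet $F$ of $P$, the set $\mathcal{E}(P)\cap F$ contains a basis of the lattice $\mathbb{Z}^n$. Consequently $P$ also satisfies the weak Ewald condition: $\mathcal{E}(P)$ contains a basis of $\mathbb{Z}^n$. -/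

import Mathlib

/-- The inclusion of `ℤⁿ` into `ℝⁿ`. -/
def latticeVec {n : ℕ} (z : Fin n → ℤ) : Fin n → ℝ := fun i => (z i : ℝ)

/-- An integer vector is primitive if it is not a multiple of an integer vector by a non-unit
(in particular it is nonzero). -/
def IsPrimitiveVec {n : ℕ} (z : Fin n → ℤ) : Prop :=
  ∀ (k : ℤ) (w : Fin n → ℤ), z = k • w → IsUnit k

/-- `B` is a unimodular basis, that is, a basis of the lattice `ℤⁿ`. -/
def IsUnimodularBasis {n : ℕ} (B : Set (Fin n → ℤ)) : Prop :=
  LinearIndepOn ℤ id B ∧ Submodule.span ℤ B = ⊤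

/-- A polytope: the convex hull of finitely many points. -/
def IsPolytope {n : ℕ} (P : Set (Fin n → ℝ)) : Prop :=
  ∃ S : Set (Fin n → ℝ), S.Finite ∧ P = convexHull ℝ S

/-- Nonempty faces of a polytope `P`: the sets of maximizers on `P` of linear functionals.
The polytope `P` itself is included. -/
def IsFace {n : ℕ} (P f : Set (Fin n → ℝ)) : Prop :=
  f.Nonempty ∧ IsExposed ℝ P f

/-- The dimension of (the affine span of) a nonempty set. -/
noncomputable def faceDim {n : ℕ} (f : Set (Fin n → ℝ)) : ℕ :=
  Module.finrank ℝ (vectorSpan ℝ f)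

/-- `v` is a vertex of `P`. -/
def IsVertex {n : ℕ} (P : Set (Fin n → ℝ)) (v : Fin n → ℝ) : Prop :=
  IsFace P {v}

/-- `e` is an edge (one-dimensional face) of `P`. -/
def IsEdge {n : ℕ} (P e : Set (Fin n → ℝ)) : Prop :=
  IsFace P e ∧ faceDim e = 1

/-- `F` is a facet (face of codimension one) of the full-dimensional polytope `P`. -/
def IsFacet {n : ℕ} (P F : Set (Fin n → ℝ)) : Prop :=
  IsFace P F ∧ faceDim F + 1 = n

/-- `R` is a ridge (face of codimension two) of the full-dimensional polytope `P`. -/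
def IsRidge {n : ℕ} (P R : Set (Fin n → ℝ)) : Prop :=
  IsFace P R ∧ faceDim R + 2 = n

/-- The primitive edge vectors of `P` at its vertex `v`: the primitive integer vectors pointing
from `v` along an edge of `P` that contains `v`. -/
def primitiveEdgeVectors {n : ℕ} (P : Set (Fin n → ℝ)) (v : Fin n → ℝ) :
    Set (Fin n → ℤ) :=
  {u | IsPrimitiveVec u ∧
    ∃ e, IsEdge P e ∧ v ∈ e ∧ ∃ t : ℝ, 0 < t ∧ v + t • latticeVec u ∈ e}

/-- Smooth polytopes in `ℝⁿ`: full-dimensional, simple, with rational edge directions, and such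
that the primitive edge vectors at each vertex form a basis of `ℤⁿ`. -/
structure IsSmoothPolytope {n : ℕ} (P : Set (Fin n → ℝ)) : Prop where
  polytope : IsPolytope P
  fullDim : (interior P).Nonempty
  simple : ∀ v, IsVertex P v → {e | IsEdge P e ∧ v ∈ e}.encard = n
  rational : ∀ e, IsEdge P e → ∃ z : Fin n → ℤ, z ≠ 0 ∧ latticeVec z ∈ vectorSpan ℝ e
  unimodular : ∀ v, IsVertex P v → IsUnimodularBasis (primitiveEdgeVectors P v)

/-- Lattice polytopes: all vertices are lattice points. -/
def IsLatticePolytope {n : ℕ} (P : Set (Fin n → ℝ)) : Prop :=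
  IsPolytope P ∧ ∀ v, IsVertex P v → ∃ z : Fin n → ℤ, v = latticeVec z

/-- The dual of a polytope `P` with the origin in its interior: the convex hull of the vectors
`y = u_F / b_F`, one for each facet `F` of `P`, where `u_F ⬝ x ≤ b_F` is an inequality defining `F`.
These are the vectors `y` such that `y ⬝ x ≤ 1` is valid on `P` and defines a facet of `P`. -/
def dualPolytope {n : ℕ} (P : Set (Fin n → ℝ)) : Set (Fin n → ℝ) :=
  convexHull ℝ {y | (∀ x ∈ P, y ⬝ᵥ x ≤ 1) ∧ IsFacet P {x | x ∈ P ∧ y ⬝ᵥ x = 1}}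

/-- Reflexive polytopes: lattice polytopes with the origin in the interior whose dual is a lattice
polytope. -/
structure IsReflexivePolytope {n : ℕ} (P : Set (Fin n → ℝ)) : Prop where
  lattice : IsLatticePolytope P
  zero_mem_interior : (0 : Fin n → ℝ) ∈ interior P
  dual_lattice : IsLatticePolytope (dualPolytope P)

/-- Monotone polytopes: smooth and reflexive. -/
def IsMonotonePolytope {n : ℕ} (P : Set (Fin n → ℝ)) : Prop :=
  IsSmoothPolytope P ∧ IsReflexivePolytope P

/-- The corner parallelepiped of a smooth polytope `P` at its vertex `v`: the points
`v + ∑ i, c i • u i` with `c i ∈ [0, 1]`, where `u` enumerates the `n` primitive edge vectors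
at `v`. -/
def cornerParallelepiped {n : ℕ} (P : Set (Fin n → ℝ)) (v : Fin n → ℝ) : Set (Fin n → ℝ) :=
  {x | ∃ u : Fin n → Fin n → ℤ, Function.Injective u ∧ Set.range u = primitiveEdgeVectors P v ∧
    ∃ c : Fin n → ℝ, (∀ i, c i ∈ Set.Icc (0 : ℝ) 1) ∧ x = v + ∑ i, c i • latticeVec (u i)}

/-- Deeply smooth polytopes: lattice smooth polytopes that contain the corner parallelepipeds at
all their vertices. -/
structure IsDeeplySmooth {n : ℕ} (P : Set (Fin n → ℝ)) : Prop where
  smooth : IsSmoothPolytope P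
  lattice : IsLatticePolytope P
  corner_subset : ∀ v, IsVertex P v → cornerParallelepiped P v ⊆ P

/-- Deeply monotone polytopes: deeply smooth and monotone. -/
def IsDeeplyMonotone {n : ℕ} (P : Set (Fin n → ℝ)) : Prop :=
  IsDeeplySmooth P ∧ IsMonotonePolytope P

/-- The Ewald set `ℤⁿ ∩ P ∩ -P`. -/
def ewaldSet {n : ℕ} (P : Set (Fin n → ℝ)) : Set (Fin n → ℤ) :=
  {z | latticeVec z ∈ P ∧ -latticeVec z ∈ P}

/-- `Star(f)`: the union of the facets containing `f`. -/
def facetStar {n : ℕ} (P f : Set (Fin n → ℝ)) : Set (Fin n → ℝ) :=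
  {x | ∃ F, IsFacet P F ∧ f ⊆ F ∧ x ∈ F}

/-- `star(f)`: the union of the ridges containing `f`. -/
def ridgeStar {n : ℕ} (P f : Set (Fin n → ℝ)) : Set (Fin n → ℝ) :=
  {x | ∃ R, IsRidge P R ∧ f ⊆ R ∧ x ∈ R}

/-- `Star*(f) = Star(f) \ star(f)`. -/
def openStar {n : ℕ} (P f : Set (Fin n → ℝ)) : Set (Fin n → ℝ) :=
  facetStar P f \ ridgeStar P f

/-- The weak Ewald condition: the Ewald set contains a unimodular basis. -/
def WeakEwald {n : ℕ} (P : Set (Fin n → ℝ)) : Prop :=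
  ∃ B : Set (Fin n → ℤ), B ⊆ ewaldSet P ∧ IsUnimodularBasis B

/-- The strong Ewald condition: for each facet `F`, the Ewald points of `P` lying in `F` contain
a unimodular basis. -/
def StrongEwald {n : ℕ} (P : Set (Fin n → ℝ)) : Prop :=
  ∀ F, IsFacet P F →
    ∃ B : Set (Fin n → ℤ), B ⊆ ewaldSet P ∧ (∀ z ∈ B, latticeVec z ∈ F) ∧ IsUnimodularBasis B

/-- The star Ewald condition for a face `f`. -/
def IsStarEwaldFace {n : ℕ} (P f : Set (Fin n → ℝ)) : Prop :=
  ∃ z ∈ ewaldSet P, latticeVec z ∈ openStar P f ∧ -latticeVec z ∉ facetStar P f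

/-- The star Ewald condition: every nonempty proper face is star Ewald. -/
def StarEwald {n : ℕ} (P : Set (Fin n → ℝ)) : Prop :=
  ∀ f, IsFace P f → f ≠ P → IsStarEwaldFace P f

/-!
A smooth reflexive polytope `P` looks near each vertex `v` like a lattice orthant: with the
primitive edge vectors `u i` at `v` and their dual integer vectors `y i` (so `y i ⬝ᵥ u j` is `-1` or
`0`), the facets through `v` are cut out by `y i ⬝ᵥ x ≤ 1`, the right hand side being one by
reflexivity (`IsVertexFrame.dotProduct_eq_one`). Hence `v = -∑ i, u i`, the corner parallelepiped at
`v` reaches exactly to the origin, and it contains every `-∑ i ∈ s, u i`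
(`IsVertexFrame.neg_sum_mem`). So `-u i ∈ P` for every edge vector; since `-u i` is an edge vector at
the other end of the edge, also `u i ∈ P`.

For two edge vectors `u a`, `u b` at `v`, the two-dimensional face they span has edge vectors `-u a`
and `u b + k • u a` at the other end of the edge along `u a`, with `k` an integer
(`IsVertexFrame.exists_shear`). Applying the above there gives points of `P` which by convexity
yield `u a + u b ∈ P` if `k ≥ 1`, and `u a - u b ∈ P` if `k ≤ 0`. As `-u a - u b ∈ P` anyway, using
this with both orders of `a` and `b` proves that `u a + u b` or `u a - u b` is an Ewald point.

For a face `f` contained in the facet of normal `y i` at `v ∈ f`, the point `-u i` lies on no other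
facet through `v`, and `u i` on none, which is the star Ewald condition. The points `-u i` and
`-u i ∓ u j` for `j ≠ i` are a unimodular basis inside that facet, which is the strong one.

The polytope theory behind this consists of three facts, proved from a finite set of generators:
a face of a face is a face (`IsFace.trans`), a vertex lies on an edge (`IsVertex.exists_isEdge`), and
a smooth polytope lies in the cone spanned by its edges at a vertex
(`IsSmoothPolytope.le_of_primitiveEdgeVectors`).
-/

/-! ### Faces of polytopes -/

/-- The continuous linear functional `x ↦ y ⬝ᵥ x`. -/
noncomputable def dotFunctional {n : ℕ} (y : Fin n → ℝ) : StrongDual ℝ (Fin n → ℝ) :=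
  ∑ i, y i • ContinuousLinearMap.proj i

@[simp]
lemma dotFunctional_apply {n : ℕ} (y x : Fin n → ℝ) : dotFunctional y x = y ⬝ᵥ x := by
  simp [dotFunctional, dotProduct]

lemma isFace_iff {n : ℕ} {P f : Set (Fin n → ℝ)} :
    IsFace P f ↔ f.Nonempty ∧ ∃ l : StrongDual ℝ (Fin n → ℝ), f = l.toExposed P :=
  ⟨fun h => ⟨h.1, h.2 h.1⟩, fun h => ⟨h.1, fun _ => h.2⟩⟩

lemma IsFace.subset {n : ℕ} {P f : Set (Fin n → ℝ)} (h : IsFace P f) : f ⊆ P :=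
  IsExposed.subset h.2

lemma isFace_toExposed {n : ℕ} {P : Set (Fin n → ℝ)} {l : StrongDual ℝ (Fin n → ℝ)}
    {v : Fin n → ℝ} (hv : v ∈ P) (hl : ∀ x ∈ P, l x ≤ l v) : IsFace P (l.toExposed P) :=
  isFace_iff.2 ⟨⟨v, hv, hl⟩, l, rfl⟩

lemma le_of_mem_convexHull {n : ℕ} {S : Set (Fin n → ℝ)} {l : StrongDual ℝ (Fin n → ℝ)} {M : ℝ}
    (h : ∀ s ∈ S, l s ≤ M) {x : Fin n → ℝ} (hx : x ∈ convexHull ℝ S) : l x ≤ M :=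
  convexHull_min h (convex_halfSpace_le l.toLinearMap.isLinear M) hx

/-- The maximizers of a functional on a convex hull are the convex combinations of the maximizers
among the generators. -/
lemma toExposed_convexHull {n : ℕ} (S : Set (Fin n → ℝ)) (l : StrongDual ℝ (Fin n → ℝ)) :
    l.toExposed (convexHull ℝ S) = convexHull ℝ (l.toExposed S) := by
  apply Set.Subset.antisymm
  · rintro x ⟨hx, hmax⟩
    have hC : Convex ℝ {z | l z ≤ l x ∧ (l z = l x → z ∈ convexHull ℝ (l.toExposed S))} := by
      rintro z ⟨hz, hz'⟩ w ⟨hw, hw'⟩ a b ha hb hab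
      simp only [Set.mem_ofPred_eq, map_add, map_smul, smul_eq_mul]
      rcases ha.eq_or_lt with rfl | ha
      · obtain rfl : b = 1 := by linarith
        simpa using ⟨hw, hw'⟩
      rcases hb.eq_or_lt with rfl | hb
      · obtain rfl : a = 1 := by linarith
        simpa using ⟨hz, hz'⟩
      have e1 : l x = a * l x + b * l x := by rw [← add_mul, hab, one_mul]
      have h1 := mul_le_mul_of_nonneg_left hz ha.le
      have h2 := mul_le_mul_of_nonneg_left hw hb.le
      refine ⟨by linarith, fun h => ?_⟩
      have h3 : a * l z = a * l x := by linarith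
      have h4 : b * l w = b * l x := by linarith
      exact convex_convexHull ℝ _ (hz' (mul_left_cancel₀ ha.ne' h3))
        (hw' (mul_left_cancel₀ hb.ne' h4)) ha.le hb.le hab
    refine (convexHull_min (fun s hs => ?_) hC hx).2 rfl
    have h1 : ∀ t ∈ S, l t ≤ l x := fun t ht => hmax t (subset_convexHull ℝ S ht)
    exact ⟨h1 s hs, fun h => subset_convexHull ℝ _ ⟨hs, fun t ht => h ▸ h1 t ht⟩⟩
  · intro x hx
    refine ⟨convexHull_mono (fun s hs => hs.1) hx, fun y hy => ?_⟩
    refine le_of_mem_convexHull (fun t ht => ?_) hy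
    have := le_of_mem_convexHull (l := -l) (M := -l t) (fun s hs => by simpa using hs.2 t ht) hx
    simpa using this

lemma IsPolytope.isPolytope_of_isFace {n : ℕ} {P f : Set (Fin n → ℝ)} (hP : IsPolytope P)
    (hf : IsFace P f) : IsPolytope f := by
  obtain ⟨S, hS, rfl⟩ := hP
  obtain ⟨-, l, rfl⟩ := isFace_iff.1 hf
  exact ⟨_, hS.subset fun s hs => hs.1, toExposed_convexHull S l⟩

lemma IsPolytope.toExposed_nonempty {n : ℕ} {P : Set (Fin n → ℝ)} (hP : IsPolytope P)
    (hne : P.Nonempty) (l : StrongDual ℝ (Fin n → ℝ)) : (l.toExposed P).Nonempty := by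
  obtain ⟨S, hS, rfl⟩ := hP
  obtain ⟨s, hs, h⟩ := Set.exists_max_image S l hS (convexHull_nonempty_iff.1 hne)
  rw [toExposed_convexHull, convexHull_nonempty_iff]
  exact ⟨s, hs, h⟩

/-- A face of a face of a polytope is a face: if `l` exposes `f` in `P` and `m` exposes `g` in `f`,
then `l + ε • m` exposes `g` in `P` for small `ε > 0`. This fails for general convex sets. -/
lemma IsFace.trans {n : ℕ} {P f g : Set (Fin n → ℝ)} (hP : IsPolytope P) (hf : IsFace P f)
    (hg : IsFace f g) : IsFace P g := by
  obtain ⟨S, hS, rfl⟩ := hP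
  obtain ⟨-, l, rfl⟩ := isFace_iff.1 hf
  obtain ⟨hne, m, rfl⟩ := isFace_iff.1 hg
  rw [toExposed_convexHull, toExposed_convexHull] at *
  obtain ⟨s₀, hs₀, hs₀'⟩ := convexHull_nonempty_iff.1 hne
  have hev : ∀ᶠ ε in nhdsWithin (0 : ℝ) (Set.Ioi 0),
      ∀ s ∈ S \ l.toExposed S, l s + ε * m s < l s₀ + ε * m s₀ := by
    rw [Filter.eventually_all_finite hS.sdiff]
    rintro s ⟨hs, hs'⟩
    have hlt : l s < l s₀ := lt_of_le_of_ne (hs₀.2 s hs)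
      fun h => hs' ⟨hs, fun t ht => h ▸ hs₀.2 t ht⟩
    apply Filter.Eventually.filter_mono nhdsWithin_le_nhds
    refine ContinuousAt.eventually_lt (by fun_prop) (by fun_prop) (by simpa using hlt)
  obtain ⟨ε, hε, hpos⟩ := (hev.and self_mem_nhdsWithin).exists
  replace hpos : 0 < ε := hpos
  refine isFace_iff.2 ⟨hne, l + ε • m, ?_⟩
  rw [toExposed_convexHull]
  congr 1
  have key : ∀ s ∈ S, l s + ε * m s ≤ l s₀ + ε * m s₀ ∧
      (l s + ε * m s = l s₀ + ε * m s₀ → s ∈ l.toExposed S ∧ m s = m s₀) := by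
    intro s hs
    by_cases hs' : s ∈ l.toExposed S
    · have h1 : l s = l s₀ := le_antisymm (hs₀.2 s hs) (hs'.2 s₀ hs₀.1)
      have h2 := mul_le_mul_of_nonneg_left (hs₀' s hs') hpos.le
      refine ⟨by linarith, fun h => ⟨hs', mul_left_cancel₀ hpos.ne' (by linarith)⟩⟩
    · have := hε s ⟨hs, hs'⟩
      exact ⟨this.le, fun h => absurd h this.ne⟩
  ext s
  constructor
  · rintro ⟨hs, hs'⟩
    refine ⟨hs.1, fun t ht => ?_⟩
    have h1 : l s = l s₀ := le_antisymm (hs₀.2 s hs.1) (hs.2 s₀ hs₀.1)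
    have h2 : m s = m s₀ := le_antisymm (hs₀' s hs) (hs' s₀ hs₀)
    simpa [h1, h2] using (key t ht).1
  · rintro ⟨hs, hs'⟩
    have h1 := hs' s₀ hs₀.1
    simp only [add_apply, smul_apply, smul_eq_mul] at h1
    obtain ⟨h2, h3⟩ := (key s hs).2 (le_antisymm (key s hs).1 h1)
    exact ⟨h2, fun t ht => h3 ▸ hs₀' t ht⟩

lemma dotProduct_self_nonneg {n : ℕ} (x : Fin n → ℝ) : 0 ≤ x ⬝ᵥ x :=
  Finset.sum_nonneg fun i _ => mul_self_nonneg (x i)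

/-- In a Euclidean ball a boundary point is the only point of the ball maximizing the functional
it represents. -/
lemma eq_of_dotProduct_le {n : ℕ} {p q : Fin n → ℝ} (h : p ⬝ᵥ p ≤ q ⬝ᵥ q)
    (h' : q ⬝ᵥ q ≤ q ⬝ᵥ p) : p = q := by
  have h1 : (p - q) ⬝ᵥ (p - q) = 0 := by
    apply le_antisymm _ (dotProduct_self_nonneg _)
    rw [sub_dotProduct, dotProduct_sub, dotProduct_sub, dotProduct_comm p q]
    linarith
  exact sub_eq_zero.1 (dotProduct_self_eq_zero.1 h1)

lemma dotProduct_le_of_self_le {n : ℕ} {p q : Fin n → ℝ} (h : p ⬝ᵥ p ≤ q ⬝ᵥ q) :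
    q ⬝ᵥ p ≤ q ⬝ᵥ q := by
  by_contra! h'
  rw [eq_of_dotProduct_le h h'.le] at h'
  exact lt_irrefl _ h'

/-- Every nonempty polytope has a vertex: a generator farthest from the origin. -/
lemma IsPolytope.exists_isVertex {n : ℕ} {P : Set (Fin n → ℝ)} (hP : IsPolytope P)
    (hne : P.Nonempty) : ∃ v ∈ P, IsVertex P v := by
  obtain ⟨S, hS, rfl⟩ := hP
  obtain ⟨s, hs, h⟩ :=
    Set.exists_max_image S (fun s => s ⬝ᵥ s) hS (convexHull_nonempty_iff.1 hne)
  refine ⟨s, subset_convexHull ℝ S hs, isFace_iff.2 ⟨⟨s, rfl⟩, dotFunctional s, ?_⟩⟩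
  rw [toExposed_convexHull]
  have : (dotFunctional s).toExposed S = {s} := by
    ext t
    constructor
    · rintro ⟨ht, ht'⟩
      exact eq_of_dotProduct_le (h t ht) (by simpa using ht' s hs)
    · rintro rfl
      exact ⟨hs, fun t ht => by simpa using dotProduct_le_of_self_le (h t ht)⟩
  rw [this, convexHull_singleton]

lemma IsFace.exists_isVertex {n : ℕ} {P f : Set (Fin n → ℝ)} (hP : IsPolytope P)
    (hf : IsFace P f) : ∃ v ∈ f, IsVertex P v := by
  obtain ⟨v, hv, h⟩ := (hP.isPolytope_of_isFace hf).exists_isVertex hf.1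
  exact ⟨v, hv, hf.trans hP h⟩

lemma IsVertex.mem {n : ℕ} {P : Set (Fin n → ℝ)} {v : Fin n → ℝ} (h : IsVertex P v) : v ∈ P :=
  IsFace.subset h rfl

lemma IsVertex.exists_functional {n : ℕ} {P : Set (Fin n → ℝ)} {v : Fin n → ℝ}
    (h : IsVertex P v) :
    ∃ l : StrongDual ℝ (Fin n → ℝ), ∀ x ∈ P, x ≠ v → l x < l v := by
  obtain ⟨-, l, hl⟩ := isFace_iff.1 h
  have hv : v ∈ l.toExposed P := hl ▸ rfl
  refine ⟨l, fun x hx hxv => lt_of_le_of_ne (hv.2 x hx) fun h => hxv ?_⟩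
  have : x ∈ l.toExposed P := ⟨hx, fun y hy => h ▸ hv.2 y hy⟩
  rwa [← hl] at this

lemma isVertex_of_isFace {n : ℕ} {P f : Set (Fin n → ℝ)} {v : Fin n → ℝ} (h : IsVertex P v)
    (hf : f ⊆ P) (hv : v ∈ f) : IsVertex f v := by
  obtain ⟨l, hl⟩ := h.exists_functional
  refine isFace_iff.2 ⟨⟨v, rfl⟩, l, ?_⟩
  ext x
  constructor
  · rintro rfl
    refine ⟨hv, fun y hy => ?_⟩
    by_cases hyx : y = x
    · rw [hyx]
    · exact (hl y (hf hy) hyx).le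
  · rintro ⟨hx, hx'⟩
    by_contra hxv
    exact absurd (hx' v hv) (not_le.2 (hl x (hf hx) hxv))

lemma IsVertex.mem_of_convexHull {n : ℕ} {S : Set (Fin n → ℝ)} {v : Fin n → ℝ}
    (h : IsVertex (convexHull ℝ S) v) : v ∈ S := by
  obtain ⟨-, l, hl⟩ := isFace_iff.1 h
  rw [toExposed_convexHull] at hl
  obtain ⟨s, hs⟩ := convexHull_nonempty_iff.1 (hl ▸ Set.singleton_nonempty v)
  have : s ∈ ({v} : Set (Fin n → ℝ)) := hl ▸ subset_convexHull ℝ _ hs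
  rw [← Set.mem_singleton_iff.1 this]
  exact hs.1

/-- A vertex of a polytope that is not a point lies on an edge. The edge is found in the vertex
figure, the central projection of the generators from `v` to a hyperplane, where the farthest
point from the origin is exposed. -/
lemma IsVertex.exists_isEdge {n : ℕ} {P : Set (Fin n → ℝ)} (hP : IsPolytope P) {v : Fin n → ℝ}
    (hv : IsVertex P v) (hne : ∃ x ∈ P, x ≠ v) :
    ∃ e, IsEdge P e ∧ v ∈ e ∧ ∃ s ∈ e, s ≠ v := by
  obtain ⟨S, hS, rfl⟩ := hP
  have hvS := hv.mem_of_convexHull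
  obtain ⟨h, hh⟩ := hv.exists_functional
  have hhS : ∀ s ∈ S, s ≠ v → 0 < h v - h s := fun s hs hsv =>
    sub_pos.2 (hh s (subset_convexHull ℝ S hs) hsv)
  set p : (Fin n → ℝ) → (Fin n → ℝ) := fun s => (h v - h s)⁻¹ • (s - v) with hp
  have hpmul : ∀ s ∈ S, s ≠ v → s - v = (h v - h s) • p s := fun s hs hsv => by
    rw [hp, smul_inv_smul₀ (hhS s hs hsv).ne']
  have hne' : (S \ {v}).Nonempty := by
    by_contra hcon
    obtain ⟨x, hx, hxv⟩ := hne
    have : S ⊆ {v} := Set.sdiff_eq_empty.1 (Set.not_nonempty_iff_eq_empty.1 hcon)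
    exact hxv (convexHull_min this (convex_singleton v) hx)
  obtain ⟨s₀, ⟨hs₀, hs₀v⟩, hmax⟩ :=
    Set.exists_max_image (S \ {v}) (fun s => p s ⬝ᵥ p s) hS.sdiff hne'
  set q := p s₀ with hq
  set l : StrongDual ℝ (Fin n → ℝ) := dotFunctional q + (q ⬝ᵥ q) • h with hl
  have hdiff : ∀ s ∈ S, s ≠ v → l s - l v = (h v - h s) * (q ⬝ᵥ p s - q ⬝ᵥ q) := by
    intro s hs hsv
    have h1 : q ⬝ᵥ s - q ⬝ᵥ v = (h v - h s) * (q ⬝ᵥ p s) := by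
      rw [← dotProduct_sub, hpmul s hs hsv, dotProduct_smul, smul_eq_mul]
    simp only [hl, add_apply, smul_apply, smul_eq_mul,
      dotFunctional_apply]
    linear_combination h1
  have hle : ∀ s ∈ S, l s ≤ l v := by
    intro s hs
    by_cases hsv : s = v
    · rw [hsv]
    · have h1 := dotProduct_le_of_self_le (hmax s ⟨hs, hsv⟩)
      have h2 := hdiff s hs hsv
      nlinarith [hhS s hs hsv]
  have hvT : v ∈ l.toExposed S := ⟨hvS, hle⟩
  have hsT : s₀ ∈ l.toExposed S := by
    refine ⟨hs₀, fun t ht => (hle t ht).trans (le_of_eq ?_)⟩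
    have := hdiff s₀ hs₀ hs₀v
    rw [← hq, sub_self, mul_zero] at this
    linarith
  have hve : v ∈ l.toExposed (convexHull ℝ S) := by
    rw [toExposed_convexHull]; exact subset_convexHull ℝ _ hvT
  have hse : s₀ ∈ l.toExposed (convexHull ℝ S) := by
    rw [toExposed_convexHull]; exact subset_convexHull ℝ _ hsT
  have hspan : vectorSpan ℝ (l.toExposed (convexHull ℝ S)) = ℝ ∙ (s₀ - v) := by
    apply le_antisymm
    · rw [toExposed_convexHull, ← direction_affineSpan, affineSpan_convexHull,
        direction_affineSpan, vectorSpan_eq_span_vsub_set_right ℝ hvT, Submodule.span_le]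
      rintro _ ⟨s, hs, rfl⟩
      rw [SetLike.mem_coe, Submodule.mem_span_singleton]
      change ∃ a : ℝ, a • (s₀ - v) = s - v
      by_cases hsv : s = v
      · exact ⟨0, by simp [hsv]⟩
      have h1 := hdiff s hs.1 hsv
      have h2 : l s = l v := le_antisymm (hle s hs.1) (hs.2 v hvS)
      rw [h2, sub_self, eq_comm, mul_eq_zero] at h1
      have h3 := h1.resolve_left (hhS s hs.1 hsv).ne'
      have h4 : p s = q := eq_of_dotProduct_le (hmax s ⟨hs.1, hsv⟩) (by linarith)
      refine ⟨(h v - h s) * (h v - h s₀)⁻¹, ?_⟩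
      rw [mul_smul]
      conv_rhs => rw [hpmul s hs.1 hsv, h4]
    · rw [Submodule.span_singleton_le_iff_mem, ← vsub_eq_sub]
      exact vsub_mem_vectorSpan ℝ hse hve
  refine ⟨_, ⟨isFace_iff.2 ⟨⟨v, hve⟩, l, rfl⟩, ?_⟩, hve, s₀, hse, hs₀v⟩
  rw [faceDim, hspan, finrank_span_singleton (sub_ne_zero.2 hs₀v)]

/-! ### Edge directions -/

@[simp]
lemma latticeVec_add {n : ℕ} (z w : Fin n → ℤ) :
    latticeVec (z + w) = latticeVec z + latticeVec w := by
  ext; simp [latticeVec]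

@[simp]
lemma latticeVec_neg {n : ℕ} (z : Fin n → ℤ) : latticeVec (-z) = -latticeVec z := by
  ext; simp [latticeVec]

@[simp]
lemma latticeVec_sub {n : ℕ} (z w : Fin n → ℤ) :
    latticeVec (z - w) = latticeVec z - latticeVec w := by
  ext; simp [latticeVec]

@[simp]
lemma latticeVec_zero {n : ℕ} : latticeVec (0 : Fin n → ℤ) = 0 := by
  ext; simp [latticeVec]

@[simp]
lemma latticeVec_smul {n : ℕ} (k : ℤ) (z : Fin n → ℤ) :
    latticeVec (k • z) = (k : ℝ) • latticeVec z := by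
  ext; simp [latticeVec]

lemma latticeVec_injective {n : ℕ} : Function.Injective (latticeVec (n := n)) := fun z w h => by
  ext i; simpa [latticeVec] using congrFun h i

lemma latticeVec_dotProduct {n : ℕ} (z w : Fin n → ℤ) :
    latticeVec z ⬝ᵥ latticeVec w = ((z ⬝ᵥ w : ℤ) : ℝ) := by
  simp [latticeVec, dotProduct]

lemma IsPrimitiveVec.neg {n : ℕ} {z : Fin n → ℤ} (h : IsPrimitiveVec z) :
    IsPrimitiveVec (-z) := fun k w hw => h k (-w) (by rw [smul_neg, ← hw, neg_neg])

lemma exists_eq_smul_isPrimitiveVec {n : ℕ} {z : Fin n → ℤ} (hz : z ≠ 0) :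
    ∃ (d : ℤ) (u : Fin n → ℤ), z = d • u ∧ IsPrimitiveVec u := by
  obtain ⟨i, -⟩ := Function.ne_iff.1 hz
  obtain ⟨g, hg, hg1⟩ := Finset.extract_gcd z (s := Finset.univ) ⟨i, Finset.mem_univ i⟩
  refine ⟨Finset.univ.gcd z, g, funext fun j => by simpa using hg j (Finset.mem_univ j), ?_⟩
  intro k w hw
  refine isUnit_of_dvd_one (hg1 ▸ Finset.dvd_gcd fun j _ => ?_)
  exact ⟨w j, by rw [hw]; rfl⟩

lemma IsEdge.exists_smul_of_mem {n : ℕ} {P e : Set (Fin n → ℝ)} (he : IsEdge P e)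
    {d : Fin n → ℝ} (hd : d ∈ vectorSpan ℝ e) (hd0 : d ≠ 0) {x : Fin n → ℝ}
    (hx : x ∈ vectorSpan ℝ e) : ∃ c : ℝ, c • d = x := by
  obtain ⟨c, hc⟩ := exists_smul_eq_of_finrank_eq_one (K := ℝ) (V := vectorSpan ℝ e) he.2
    (x := ⟨d, hd⟩) (by simpa using hd0) ⟨x, hx⟩
  exact ⟨c, congrArg Subtype.val hc⟩

/-- An edge of a smooth polytope through a vertex has a primitive edge vector pointing along it. -/
lemma IsEdge.exists_primitiveEdgeVector {n : ℕ} {P e : Set (Fin n → ℝ)}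
    (hP : IsSmoothPolytope P) (he : IsEdge P e) {v s : Fin n → ℝ} (hv : v ∈ e) (hs : s ∈ e)
    (hsv : s ≠ v) :
    ∃ u ∈ primitiveEdgeVectors P v, ∃ c : ℝ, 0 < c ∧ latticeVec u = c • (s - v) := by
  obtain ⟨z, hz, hze⟩ := hP.rational e he
  obtain ⟨d, u, rfl, hu⟩ := exists_eq_smul_isPrimitiveVec hz
  have hsv' : s - v ∈ vectorSpan ℝ e := vsub_mem_vectorSpan ℝ hs hv
  obtain ⟨c, hc⟩ := he.exists_smul_of_mem hsv' (sub_ne_zero.2 hsv) hze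
  have hd : (d : ℝ) ≠ 0 := by
    intro h
    rw [Int.cast_eq_zero] at h
    simp [h] at hz
  have hc0 : c ≠ 0 := by
    rintro rfl
    rw [zero_smul, eq_comm] at hc
    exact hz (latticeVec_injective (by rw [hc, latticeVec_zero]))
  have huc : latticeVec u = ((d : ℝ)⁻¹ * c) • (s - v) := by
    rw [mul_smul, hc, latticeVec_smul, inv_smul_smul₀ hd]
  have mem : ∀ w : Fin n → ℤ, IsPrimitiveVec w → ∀ a : ℝ, 0 < a → latticeVec w = a • (s - v) →
      ∃ u ∈ primitiveEdgeVectors P v, ∃ c : ℝ, 0 < c ∧ latticeVec u = c • (s - v) := by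
    intro w hw a ha hwa
    refine ⟨w, ⟨hw, e, he, hv, a⁻¹, inv_pos.2 ha, ?_⟩, a, ha, hwa⟩
    rw [hwa, inv_smul_smul₀ ha.ne', add_sub_cancel]
    exact hs
  rcases lt_or_gt_of_ne (mul_ne_zero (inv_ne_zero hd) hc0) with h | h
  · exact mem (-u) hu.neg _ (neg_pos.2 h) (by rw [latticeVec_neg, huc, neg_smul])
  · exact mem u hu _ h huc

/-- A smooth polytope lies in the cone spanned by its edges at a vertex `v`. If `w` increased from
`v` to some point, then a face on which the slope of `w` against a functional exposing `v` is
maximal would have an edge at `v` along which `w` increases. -/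
lemma IsSmoothPolytope.le_of_primitiveEdgeVectors {n : ℕ} {P : Set (Fin n → ℝ)}
    (hP : IsSmoothPolytope P) {v : Fin n → ℝ} (hv : IsVertex P v)
    (w : StrongDual ℝ (Fin n → ℝ)) (hw : ∀ u ∈ primitiveEdgeVectors P v, w (latticeVec u) ≤ 0)
    {x : Fin n → ℝ} (hx : x ∈ P) : w x ≤ w v := by
  obtain ⟨h, hh⟩ := hv.exists_functional
  obtain ⟨S, hS, hPS⟩ := hP.polytope
  have hSP : S ⊆ P := hPS ▸ subset_convexHull ℝ S
  have hvS : v ∈ S := (hPS ▸ hv).mem_of_convexHull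
  by_contra! hcon
  obtain ⟨s₁, hs₁, hs₁w⟩ : ∃ s ∈ S, w v < w s := by
    by_contra! hall
    exact absurd (le_of_mem_convexHull hall (hPS ▸ hx)) (not_le.2 hcon)
  have hs₁v : s₁ ≠ v := by rintro rfl; exact lt_irrefl _ hs₁w
  obtain ⟨s₀, ⟨hs₀, hs₀v⟩, hmax⟩ := Set.exists_max_image (S \ {v})
    (fun s => (w s - w v) / (h v - h s)) hS.sdiff ⟨s₁, hs₁, hs₁v⟩
  set m := (w s₀ - w v) / (h v - h s₀) with hm
  have hpos : ∀ s ∈ P, s ≠ v → 0 < h v - h s := fun s hs hsv => sub_pos.2 (hh s hs hsv)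
  have hm0 : 0 < m := lt_of_lt_of_le (div_pos (sub_pos.2 hs₁w) (hpos s₁ (hSP hs₁) hs₁v))
    (hmax s₁ ⟨hs₁, hs₁v⟩)
  set l : StrongDual ℝ (Fin n → ℝ) := w + m • h with hl
  have hlapp : ∀ y, l y = w y + m * h y := fun y => by simp [hl]
  have hle : ∀ y ∈ P, l y ≤ l v := by
    intro y hy
    rw [hPS] at hy
    refine le_of_mem_convexHull (fun s hs => ?_) hy
    by_cases hsv : s = v
    · rw [hsv]
    have h1 := hmax s ⟨hs, hsv⟩
    rw [div_le_iff₀ (hpos s (hSP hs) hsv)] at h1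
    rw [hlapp, hlapp]
    linarith
  have hg : IsFace P (l.toExposed P) := isFace_toExposed hv.mem hle
  have hs₀g : s₀ ∈ l.toExposed P := by
    refine ⟨hSP hs₀, fun y hy => (hle y hy).trans (le_of_eq ?_)⟩
    have : m * (h v - h s₀) = w s₀ - w v := div_mul_cancel₀ _ (hpos s₀ (hSP hs₀) hs₀v).ne'
    rw [hlapp, hlapp]
    linarith
  have hvg : v ∈ l.toExposed P := ⟨hv.mem, hle⟩
  obtain ⟨e, he, hve, s, hse, hsv⟩ := (isVertex_of_isFace hv hg.subset hvg).exists_isEdge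
    (hP.polytope.isPolytope_of_isFace hg) ⟨s₀, hs₀g, hs₀v⟩
  have heP : IsEdge P e := ⟨hg.trans hP.polytope he.1, he.2⟩
  obtain ⟨u, hu, c, hc, huc⟩ := heP.exists_primitiveEdgeVector hP hve hse hsv
  have hsg := he.1.subset hse
  have h1 : l s = l v := le_antisymm (hle s hsg.1) (hsg.2 v hv.mem)
  rw [hlapp, hlapp] at h1
  have h2 : 0 < w s - w v := by
    have := mul_pos hm0 (hpos s hsg.1 hsv)
    linarith
  have h3 := hw u hu
  rw [huc, map_smul, map_sub, smul_eq_mul] at h3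
  exact absurd h3 (not_le.2 (mul_pos hc h2))

/-- The other end of an edge: the edge vector `u` at `v` leads to a vertex at which `-u` is an edge
vector. -/
lemma exists_isVertex_neg_mem_primitiveEdgeVectors {n : ℕ} {P : Set (Fin n → ℝ)}
    (hP : IsPolytope P) {v : Fin n → ℝ} {u : Fin n → ℤ} (hu : u ∈ primitiveEdgeVectors P v) :
    ∃ τ : ℝ, IsVertex P (v + τ • latticeVec u) ∧
      -u ∈ primitiveEdgeVectors P (v + τ • latticeVec u) := by
  obtain ⟨hprim, e, he, hve, t, ht, hte⟩ := hu
  set d := latticeVec u with hd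
  have hpoly := hP.isPolytope_of_isFace he.1
  have hd0 : d ≠ 0 := by
    intro h0
    have : u = (0 : ℤ) • u := by
      rw [zero_smul]; exact latticeVec_injective (by rw [← hd, h0, latticeVec_zero])
    simpa using hprim 0 u this
  have hdd : 0 < d ⬝ᵥ d := lt_of_le_of_ne (dotProduct_self_nonneg d)
    fun h => hd0 (dotProduct_self_eq_zero.1 h.symm)
  have hdmem : d ∈ vectorSpan ℝ e := by
    have := Submodule.smul_mem (vectorSpan ℝ e) t⁻¹ (vsub_mem_vectorSpan ℝ hte hve)
    simpa [smul_smul, ht.ne'] using this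
  have hline : ∀ x ∈ e, ∃ c : ℝ, x = v + c • d := by
    intro x hx
    obtain ⟨c, hc⟩ := he.exists_smul_of_mem hdmem hd0 (vsub_mem_vectorSpan ℝ hx hve)
    exact ⟨c, by rw [hc]; simp⟩
  obtain ⟨x, hx, hmax⟩ := hpoly.toExposed_nonempty he.1.1 (dotFunctional d)
  obtain ⟨τ, rfl⟩ := hline x hx
  have hmono : ∀ a b : ℝ, dotFunctional d (v + a • d) ≤ dotFunctional d (v + b • d) → a ≤ b := by
    intro a b hab
    simp only [dotFunctional_apply, dotProduct_add, dotProduct_smul, smul_eq_mul] at hab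
    exact le_of_mul_le_mul_right (by linarith) hdd
  have hτ : 0 < τ := ht.trans_le (hmono t τ (hmax _ hte))
  refine ⟨τ, he.1.trans hP (isFace_iff.2 ⟨⟨_, rfl⟩, dotFunctional d, ?_⟩), hprim.neg, e, he, hx,
    τ, hτ, by simpa [← hd] using hve⟩
  ext y
  constructor
  · rintro rfl
    exact ⟨hx, hmax⟩
  · rintro ⟨hy, hy'⟩
    obtain ⟨c, rfl⟩ := hline y hy
    rw [le_antisymm (hmono _ _ (hmax _ hy)) (hmono _ _ (hy' _ hx))]
    rfl

/-! ### Local structure at a vertex -/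

/-- Negatively dual families expand every vector. -/
lemma eq_neg_sum_of_dual {R : Type*} [CommRing R] {n : ℕ} {u y : Fin n → Fin n → R}
    (h : ∀ i j, y i ⬝ᵥ u j = if i = j then -1 else 0) (x : Fin n → R) :
    x = -∑ i, (y i ⬝ᵥ x) • u i := by
  have h1 : Matrix.of y * (-(Matrix.of u).transpose) = 1 := by
    ext i j
    have := h i j
    rw [Matrix.mul_neg, Matrix.neg_apply, Matrix.mul_apply, Matrix.one_apply]
    simp only [dotProduct] at this
    simp only [Matrix.of_apply, Matrix.transpose_apply, this]
    split_ifs <;> simp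
  have h2 := congrArg (fun M => M.mulVec x) (mul_eq_one_comm.1 h1)
  simp only [← Matrix.mulVec_mulVec, Matrix.one_mulVec] at h2
  conv_lhs => rw [← h2]
  ext k
  simp [Matrix.mulVec, dotProduct, mul_comm]

/-- The edge vectors `u` of a polytope `P` at a vertex `v`, enumerated together with their dual
integer vectors `y`. The sign is such that `y i` is the outer normal of the facet through `v` that
contains all edges except the one along `u i`. -/
structure IsVertexFrame {n : ℕ} (P : Set (Fin n → ℝ)) (v : Fin n → ℝ)
    (u y : Fin n → Fin n → ℤ) : Prop where
  range_eq : Set.range u = primitiveEdgeVectors P v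
  dual : ∀ i j, y i ⬝ᵥ u j = if i = j then -1 else 0
  corner : ∀ c : Fin n → ℝ, (∀ i, c i ∈ Set.Icc (0 : ℝ) 1) →
    v + ∑ i, c i • latticeVec (u i) ∈ P
  le : ∀ i, ∀ x ∈ P, latticeVec (y i) ⬝ᵥ x ≤ latticeVec (y i) ⬝ᵥ v

lemma IsDeeplySmooth.exists_isVertexFrame {n : ℕ} {P : Set (Fin n → ℝ)} (hP : IsDeeplySmooth P)
    {v : Fin n → ℝ} (hv : IsVertex P v) : ∃ u y, IsVertexFrame P v u y := by
  obtain ⟨hli, hsp⟩ := hP.smooth.unimodular v hv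
  let b₀ : Module.Basis (primitiveEdgeVectors P v) ℤ (Fin n → ℤ) :=
    Module.Basis.mk (v := fun x : primitiveEdgeVectors P v => (x : Fin n → ℤ)) hli
      (by rw [Subtype.range_coe, hsp])
  let e := b₀.indexEquiv (Pi.basisFun ℤ (Fin n))
  let b := b₀.reindex e
  have hb : ∀ i, b i = (e.symm i : Fin n → ℤ) := fun i => by
    rw [Module.Basis.reindex_apply]
    exact Module.Basis.mk_apply _ _ _
  have hrange : Set.range b = primitiveEdgeVectors P v := by
    ext z
    constructor
    · rintro ⟨i, rfl⟩
      rw [hb]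
      exact (e.symm i).2
    · intro hz
      exact ⟨e ⟨z, hz⟩, by rw [hb, e.symm_apply_apply]⟩
  let y : Fin n → Fin n → ℤ := fun i k => -b.coord i (fun j => if k = j then 1 else 0)
  have hy : ∀ i z, y i ⬝ᵥ z = -b.coord i z := by
    intro i z
    rw [LinearMap.pi_apply_eq_sum_univ (b.coord i) z]
    simp [y, dotProduct, mul_comm]
  have hdual : ∀ i j, y i ⬝ᵥ b j = if i = j then -1 else 0 := by
    intro i j
    rw [hy, Module.Basis.coord_apply, Module.Basis.repr_self, Finsupp.single_apply]
    simp only [eq_comm (a := j)]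
    split_ifs <;> simp
  refine ⟨b, y, hrange, hdual, fun c hc => ?_, fun i x hx => ?_⟩
  · exact hP.corner_subset v hv ⟨b, b.injective, hrange, c, hc, rfl⟩
  · have := hP.smooth.le_of_primitiveEdgeVectors hv (dotFunctional (latticeVec (y i))) ?_ hx
    · simpa using this
    · rw [← hrange]
      rintro _ ⟨j, rfl⟩
      rw [dotFunctional_apply, latticeVec_dotProduct, hdual]
      split_ifs <;> simp

namespace IsVertexFrame

variable {n : ℕ} {P : Set (Fin n → ℝ)} {v : Fin n → ℝ} {u y : Fin n → Fin n → ℤ}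

lemma real_dual (h : IsVertexFrame P v u y) (i j : Fin n) :
    latticeVec (y i) ⬝ᵥ latticeVec (u j) = if i = j then -1 else 0 := by
  rw [latticeVec_dotProduct, h.dual]
  split_ifs <;> simp

lemma eq_neg_sum (h : IsVertexFrame P v u y) (x : Fin n → ℝ) :
    x = -∑ i, (latticeVec (y i) ⬝ᵥ x) • latticeVec (u i) :=
  eq_neg_sum_of_dual h.real_dual x

lemma dotProduct_ext (h : IsVertexFrame P v u y) {a b : Fin n → ℝ}
    (hab : ∀ i, a ⬝ᵥ latticeVec (u i) = b ⬝ᵥ latticeVec (u i)) : a = b := by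
  have : ∀ x, a ⬝ᵥ x = b ⬝ᵥ x := fun x => by
    rw [h.eq_neg_sum x]
    simp [dotProduct_sum, hab]
  exact dotProduct_eq _ _ this

lemma mem (h : IsVertexFrame P v u y) : v ∈ P := by
  simpa using h.corner 0 fun i => by simp

lemma add_sum_mem (h : IsVertexFrame P v u y) (s : Finset (Fin n)) :
    v + ∑ i ∈ s, latticeVec (u i) ∈ P := by
  have := h.corner (fun i => if i ∈ s then 1 else 0) fun i => by split_ifs <;> simp
  simpa using this

lemma add_mem (h : IsVertexFrame P v u y) (i : Fin n) : v + latticeVec (u i) ∈ P := by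
  simpa using h.add_sum_mem {i}

lemma linearIndependent (h : IsVertexFrame P v u y) :
    LinearIndependent ℝ fun i => latticeVec (u i) := by
  apply linearIndependent_of_top_le_span_of_card_eq_finrank
  · intro x _
    rw [h.eq_neg_sum x]
    exact Submodule.neg_mem _ (Submodule.sum_mem _ fun i _ =>
      Submodule.smul_mem _ _ (Submodule.subset_span ⟨i, rfl⟩))
  · simp

/-- The intersection of `k` facets through a vertex has codimension `k`. -/
lemma faceDim_add_card (h : IsVertexFrame P v u y) (I : Finset (Fin n)) :
    faceDim {x | x ∈ P ∧ ∀ i ∈ I, latticeVec (y i) ⬝ᵥ x = latticeVec (y i) ⬝ᵥ v} + I.card = n := by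
  set f := {x | x ∈ P ∧ ∀ i ∈ I, latticeVec (y i) ⬝ᵥ x = latticeVec (y i) ⬝ᵥ v} with hf
  have hvf : v ∈ f := ⟨h.mem, fun _ _ => rfl⟩
  have hspan : vectorSpan ℝ f =
      Submodule.span ℝ (Set.range fun k : {k // k ∈ Iᶜ} => latticeVec (u k)) := by
    apply le_antisymm
    · rw [vectorSpan_eq_span_vsub_set_right ℝ hvf, Submodule.span_le]
      rintro _ ⟨x, hx, rfl⟩
      change x - v ∈ _
      rw [h.eq_neg_sum (x - v)]
      refine Submodule.neg_mem _ (Submodule.sum_mem _ fun i _ => ?_)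
      by_cases hi : i ∈ I
      · rw [dotProduct_sub, hx.2 i hi, sub_self, zero_smul]
        exact Submodule.zero_mem _
      · exact Submodule.smul_mem _ _
          (Submodule.subset_span ⟨⟨i, Finset.mem_compl.2 hi⟩, rfl⟩)
    · rw [Submodule.span_le]
      rintro _ ⟨⟨k, hk⟩, rfl⟩
      have hkf : v + latticeVec (u k) ∈ f := by
        refine ⟨h.add_mem k, fun i hi => ?_⟩
        rw [dotProduct_add, h.real_dual, if_neg, add_zero]
        rintro rfl
        exact Finset.mem_compl.1 hk hi
      simpa using vsub_mem_vectorSpan ℝ hkf hvf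
  have hli : LinearIndependent ℝ fun k : {k // k ∈ Iᶜ} => latticeVec (u k) :=
    h.linearIndependent.comp _ Subtype.val_injective
  rw [faceDim, hspan, finrank_span_eq_card hli, Fintype.card_coe, add_comm,
    Finset.card_add_card_compl, Fintype.card_fin]

lemma isFacet (h : IsVertexFrame P v u y) (i : Fin n) :
    IsFacet P {x | x ∈ P ∧ latticeVec (y i) ⬝ᵥ x = latticeVec (y i) ⬝ᵥ v} := by
  refine ⟨isFace_iff.2 ⟨⟨v, h.mem, rfl⟩, dotFunctional (latticeVec (y i)), ?_⟩, ?_⟩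
  · ext x
    simp only [ContinuousLinearMap.toExposed, Set.mem_ofPred_eq, dotFunctional_apply]
    refine and_congr_right fun hx => ⟨fun hxv z hz => hxv ▸ h.le i z hz, fun hx' => ?_⟩
    exact le_antisymm (h.le i x hx) (hx' v h.mem)
  · simpa using h.faceDim_add_card {i}

/-- Every face through a vertex is an intersection of facets: the coefficients of its defining
functional in terms of the facet normals at the vertex are nonnegative, and the face is the
intersection of the facets with a positive coefficient. -/
lemma exists_eq_of_isFace (h : IsVertexFrame P v u y) {f : Set (Fin n → ℝ)} (hf : IsFace P f)
    (hv : v ∈ f) : ∃ I : Finset (Fin n),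
      f = {x | x ∈ P ∧ ∀ i ∈ I, latticeVec (y i) ⬝ᵥ x = latticeVec (y i) ⬝ᵥ v} := by
  obtain ⟨-, l, rfl⟩ := isFace_iff.1 hf
  set c : Fin n → ℝ := fun i => -l (latticeVec (u i)) with hc
  have hc0 : ∀ i, 0 ≤ c i := by
    intro i
    have := hv.2 _ (h.add_mem i)
    rw [map_add] at this
    simp only [hc]
    linarith
  have hl : ∀ x, l x - l v = ∑ i, c i * (latticeVec (y i) ⬝ᵥ x - latticeVec (y i) ⬝ᵥ v) := by
    intro x
    rw [← map_sub]
    conv_lhs => rw [h.eq_neg_sum (x - v)]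
    rw [map_neg, map_sum, ← Finset.sum_neg_distrib]
    refine Finset.sum_congr rfl fun i _ => ?_
    rw [map_smul, dotProduct_sub, smul_eq_mul]
    simp only [hc]
    ring
  have hnonpos : ∀ x ∈ P, ∀ i, c i * (latticeVec (y i) ⬝ᵥ x - latticeVec (y i) ⬝ᵥ v) ≤ 0 :=
    fun x hx i => mul_nonpos_of_nonneg_of_nonpos (hc0 i) (sub_nonpos.2 (h.le i x hx))
  refine ⟨Finset.univ.filter fun i => 0 < c i, ?_⟩
  ext x
  constructor
  · rintro ⟨hx, hx'⟩
    refine ⟨hx, fun i hi => ?_⟩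
    have h0 : l x - l v = 0 := sub_eq_zero.2 (le_antisymm (hv.2 x hx) (hx' v hv.1))
    rw [hl, Finset.sum_eq_zero_iff_of_nonpos fun i _ => hnonpos x hx i] at h0
    have := (mul_eq_zero.1 (h0 i (Finset.mem_univ i))).resolve_left
      (Finset.mem_filter.1 hi).2.ne'
    exact sub_eq_zero.1 this
  · rintro ⟨hx, hx'⟩
    have h0 : l x - l v = 0 := by
      rw [hl]
      refine Finset.sum_eq_zero fun i _ => ?_
      rcases (hc0 i).eq_or_lt with hi | hi
      · rw [← hi, zero_mul]
      · rw [hx' i (Finset.mem_filter.2 ⟨Finset.mem_univ i, hi⟩), sub_self, mul_zero]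
    exact ⟨hx, fun z hz => sub_eq_zero.1 h0 ▸ hv.2 z hz⟩

/-- If `P` contains the origin in its interior, the facets have positive right hand sides. -/
lemma dotProduct_pos (h : IsVertexFrame P v u y) (h0 : (0 : Fin n → ℝ) ∈ interior P)
    (i : Fin n) : 0 < latticeVec (y i) ⬝ᵥ v := by
  have hev : ∀ᶠ ε in nhdsWithin (0 : ℝ) (Set.Ioi 0), (-ε) • latticeVec (u i) ∈ P := by
    apply Filter.Eventually.filter_mono nhdsWithin_le_nhds
    have hc : ContinuousAt (fun ε : ℝ => (-ε) • latticeVec (u i)) 0 := by fun_prop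
    refine hc.eventually_mem ?_
    simpa using mem_interior_iff_mem_nhds.1 h0
  obtain ⟨ε, hε, hpos⟩ := (hev.and self_mem_nhdsWithin).exists
  replace hpos : 0 < ε := hpos
  have := h.le i _ hε
  rw [dotProduct_smul, h.real_dual, if_pos rfl, smul_eq_mul] at this
  linarith

/-- The normal of a facet, scaled to `y ⬝ᵥ x ≤ 1`, is a vertex of the dual polytope. It is exposed
by the midpoint of the corner parallelepiped of the facet. -/
lemma isVertex_dualPolytope (h : IsVertexFrame P v u y)
    (h0 : (0 : Fin n → ℝ) ∈ interior P) (i : Fin n) :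
    IsVertex (dualPolytope P) ((latticeVec (y i) ⬝ᵥ v)⁻¹ • latticeVec (y i)) := by
  have hb := h.dotProduct_pos h0 i
  set b := latticeVec (y i) ⬝ᵥ v with hbdef
  set a := b⁻¹ • latticeVec (y i) with ha
  have hax : ∀ x, a ⬝ᵥ x = b⁻¹ * (latticeVec (y i) ⬝ᵥ x) := fun x => by
    rw [ha, smul_dotProduct, smul_eq_mul]
  have hax1 : ∀ x, a ⬝ᵥ x = 1 ↔ latticeVec (y i) ⬝ᵥ x = b := fun x => by
    rw [hax, inv_mul_eq_div, div_eq_one_iff_eq hb.ne']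
  set G := {z : Fin n → ℝ | (∀ x ∈ P, z ⬝ᵥ x ≤ 1) ∧ IsFacet P {x | x ∈ P ∧ z ⬝ᵥ x = 1}} with hG
  have haG : a ∈ G := by
    refine ⟨fun x hx => ?_, ?_⟩
    · rw [hax, inv_mul_le_one₀ hb]
      exact h.le i x hx
    · simp only [hax1]
      exact h.isFacet i
  -- The affine hull of the facet, parametrized by the edge vectors other than `u i`.
  have hq : ∀ c : Fin n → ℝ, c i = 0 →
      a ⬝ᵥ (v + ∑ j, c j • latticeVec (u j)) = 1 := by
    intro c hci
    rw [hax1, dotProduct_add, dotProduct_sum, Finset.sum_eq_zero, add_zero]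
    intro j _
    rw [dotProduct_smul, h.real_dual]
    by_cases hij : i = j
    · rw [← hij, hci, zero_smul]
    · rw [if_neg hij, smul_zero]
  set c₀ : Fin n → ℝ := fun j => if j = i then 0 else 1 / 2 with hc₀
  have hc₀mem : ∀ j, c₀ j ∈ Set.Icc (0 : ℝ) 1 := fun j => by
    simp only [hc₀]; split_ifs <;> norm_num
  set p := v + ∑ j, c₀ j • latticeVec (u j) with hp
  have hpP : p ∈ P := h.corner c₀ hc₀mem
  have hpa : a ⬝ᵥ p = 1 := hq c₀ (by simp [hc₀])
  -- Moving from the midpoint by half an edge vector in either direction stays in `P`.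
  have hmove : ∀ j, j ≠ i → ∀ ε : ℝ, |ε| ≤ 1 / 2 → p + ε • latticeVec (u j) ∈ P := by
    intro j hj ε hε
    have h1 := h.corner (c₀ + Pi.single j ε) ?_
    · simp only [Pi.add_apply, add_smul, Finset.sum_add_distrib, Pi.single_apply, ite_smul,
        zero_smul, Finset.sum_ite_eq', Finset.mem_univ, if_true] at h1
      rwa [← add_assoc] at h1
    · intro k
      rw [Pi.add_apply]
      obtain ⟨h1, h2⟩ := abs_le.1 hε
      by_cases hk : k = j
      · subst hk
        simp only [hc₀, if_neg hj, Pi.single_eq_same, Set.mem_Icc]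
        constructor <;> linarith
      · rw [Pi.single_eq_of_ne hk, add_zero]
        exact hc₀mem k
  have huniq : ∀ z ∈ G, z ⬝ᵥ p = 1 → z = a := by
    intro z hz hzp
    have hzu : ∀ j, j ≠ i → z ⬝ᵥ latticeVec (u j) = 0 := by
      intro j hj
      have h1 := hz.1 _ (hmove j hj (1 / 2) (by norm_num [abs_of_pos]))
      have h2 := hz.1 _ (hmove j hj (-(1 / 2)) (by norm_num [abs_of_pos]))
      rw [dotProduct_add, dotProduct_smul, hzp, smul_eq_mul] at h1 h2
      linarith
    have hzv : z ⬝ᵥ v = 1 := by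
      rw [hp, dotProduct_add, dotProduct_sum, Finset.sum_eq_zero, add_zero] at hzp
      · exact hzp
      · intro j _
        rw [dotProduct_smul]
        by_cases hj : j = i
        · simp [hc₀, hj]
        · rw [hzu j hj, smul_zero]
    have hzi : b * (z ⬝ᵥ latticeVec (u i)) = -1 := by
      rw [h.eq_neg_sum v, dotProduct_neg, dotProduct_sum, Finset.sum_eq_single i] at hzv
      · rw [dotProduct_smul, smul_eq_mul] at hzv
        linarith
      · intro j _ hj
        rw [dotProduct_smul, hzu j hj, smul_zero]
      · simp
    refine h.dotProduct_ext fun j => ?_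
    rw [hax, h.real_dual]
    by_cases hj : j = i
    · rw [hj, if_pos rfl, ← hzi, inv_mul_cancel_left₀ hb.ne']
    · rw [hzu j hj, if_neg (Ne.symm hj), mul_zero]
  refine isFace_iff.2 ⟨⟨a, rfl⟩, dotFunctional p, ?_⟩
  rw [dualPolytope, toExposed_convexHull]
  have : (dotFunctional p).toExposed G = {a} := by
    ext z
    constructor
    · rintro ⟨hz, hz'⟩
      have := hz' a haG
      rw [dotFunctional_apply, dotFunctional_apply, dotProduct_comm, hpa, dotProduct_comm] at this
      exact huniq z hz (le_antisymm (hz.1 p hpP) this)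
    · rintro rfl
      refine ⟨haG, fun z hz => ?_⟩
      rw [dotFunctional_apply, dotFunctional_apply, dotProduct_comm, dotProduct_comm p, hpa]
      exact hz.1 p hpP
  rw [this, convexHull_singleton]

/-- The facets of a smooth reflexive polytope are at lattice distance one from the origin. -/
lemma dotProduct_eq_one (h : IsVertexFrame P v u y) (hP : IsReflexivePolytope P)
    (hv : IsVertex P v) (i : Fin n) : latticeVec (y i) ⬝ᵥ v = 1 := by
  have hb := h.dotProduct_pos hP.zero_mem_interior i
  obtain ⟨w, hw⟩ := hP.dual_lattice.2 _ (h.isVertex_dualPolytope hP.zero_mem_interior i)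
  obtain ⟨z, rfl⟩ := hP.lattice.2 v hv
  rw [latticeVec_dotProduct] at *
  set b := y i ⬝ᵥ z
  have hyw : latticeVec (y i) = (b : ℝ) • latticeVec w := by rw [← hw, smul_inv_smul₀ hb.ne']
  have h1 := h.real_dual i i
  rw [if_pos rfl, hyw, smul_dotProduct, latticeVec_dotProduct, smul_eq_mul] at h1
  have h2 : b * (w ⬝ᵥ u i) = -1 := by exact_mod_cast h1
  have h3 : 0 < b := by exact_mod_cast hb
  have h4 : b ∣ 1 := ⟨-(w ⬝ᵥ u i), by linarith⟩
  have h5 := Int.le_of_dvd one_pos h4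
  have h6 : b = 1 := by omega
  rw [h6, Int.cast_one]

end IsVertexFrame

/-! ### Ewald points from edge vectors -/

lemma neg_mem_ewaldSet {n : ℕ} {P : Set (Fin n → ℝ)} {z : Fin n → ℤ} (h : z ∈ ewaldSet P) :
    -z ∈ ewaldSet P :=
  ⟨by simpa using h.2, by simpa using h.1⟩

lemma IsPolytope.convex {n : ℕ} {P : Set (Fin n → ℝ)} (hP : IsPolytope P) : Convex ℝ P := by
  obtain ⟨S, -, rfl⟩ := hP
  exact convex_convexHull ℝ S

namespace IsVertexFrame

variable {n : ℕ} {P : Set (Fin n → ℝ)} {v : Fin n → ℝ} {u y : Fin n → Fin n → ℤ}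

/-- In the monotone case `v = -∑ i, u i`, so the corner parallelepiped at `v` contains the origin as
the vertex opposite to `v`, and around it the negated sums of edge vectors. -/
lemma neg_sum_mem (h : IsVertexFrame P v u y) (hP : IsReflexivePolytope P) (hv : IsVertex P v)
    (s : Finset (Fin n)) : -∑ i ∈ s, latticeVec (u i) ∈ P := by
  have h1 : v = -∑ i, latticeVec (u i) := by
    conv_lhs => rw [h.eq_neg_sum v]
    simp [h.dotProduct_eq_one hP hv]
  have h2 := h.add_sum_mem sᶜ
  rw [h1, ← Finset.sum_add_sum_compl s] at h2
  simpa [neg_add, add_assoc] using h2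

lemma int_ext (h : IsVertexFrame P v u y) {z w : Fin n → ℤ}
    (hzw : ∀ i, y i ⬝ᵥ z = y i ⬝ᵥ w) : z = w := by
  rw [eq_neg_sum_of_dual h.dual z, eq_neg_sum_of_dual h.dual w]
  simp only [hzw]

/-- A facet has the same primitive normal in the frames at any two of its vertices. -/
lemma exists_normal_eq {v' : Fin n → ℝ} {u' y' : Fin n → Fin n → ℤ}
    (h : IsVertexFrame P v u y) (h' : IsVertexFrame P v' u' y') (hP : IsReflexivePolytope P)
    (hv : IsVertex P v) (hv' : IsVertex P v') (b : Fin n)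
    (hb : latticeVec (y b) ⬝ᵥ v' = latticeVec (y b) ⬝ᵥ v) : ∃ d, y' d = y b := by
  have hF := h.isFacet b
  set F := {x | x ∈ P ∧ latticeVec (y b) ⬝ᵥ x = latticeVec (y b) ⬝ᵥ v} with hFdef
  obtain ⟨I, hI⟩ := h'.exists_eq_of_isFace hF.1 ⟨hv'.mem, hb⟩
  have hcard := h'.faceDim_add_card I
  rw [← hI] at hcard
  obtain ⟨d, rfl⟩ := Finset.card_eq_one.1 (show I.card = 1 by have := hF.2; omega)
  have hd : ∀ x ∈ F, latticeVec (y' d) ⬝ᵥ x = 1 := by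
    intro x hx
    rw [hI] at hx
    rw [hx.2 d (Finset.mem_singleton_self d), h'.dotProduct_eq_one hP hv']
  have hdv : latticeVec (y' d) ⬝ᵥ v = 1 := hd v ⟨hv.mem, rfl⟩
  have hdu : ∀ j, b ≠ j → latticeVec (y' d) ⬝ᵥ latticeVec (u j) = 0 := by
    intro j hj
    have := hd (v + latticeVec (u j))
      ⟨h.add_mem j, by rw [dotProduct_add, h.real_dual, if_neg hj, add_zero]⟩
    rw [dotProduct_add, hdv] at this
    linarith
  refine ⟨d, latticeVec_injective (h.dotProduct_ext fun j => ?_)⟩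
  rw [h.real_dual]
  split_ifs with hj
  · subst hj
    rw [h.eq_neg_sum v, dotProduct_neg, dotProduct_sum, Finset.sum_eq_single b] at hdv
    · rw [dotProduct_smul, h.dotProduct_eq_one hP hv, one_smul] at hdv
      linarith
    · intro j _ hj
      rw [dotProduct_smul, hdu j hj.symm, smul_zero]
    · simp
  · exact hdu j hj

end IsVertexFrame

/-- Edge vectors lie in `P`, being the negatives of edge vectors at the other end of the edge. -/
lemma IsDeeplyMonotone.latticeVec_mem {n : ℕ} {P : Set (Fin n → ℝ)} (hP : IsDeeplyMonotone P)
    {v : Fin n → ℝ} {u : Fin n → ℤ} (hu : u ∈ primitiveEdgeVectors P v) : latticeVec u ∈ P := by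
  obtain ⟨τ, hv', hu'⟩ :=
    exists_isVertex_neg_mem_primitiveEdgeVectors hP.1.smooth.polytope hu
  obtain ⟨u', y', h'⟩ := hP.1.exists_isVertexFrame hv'
  rw [← h'.range_eq] at hu'
  obtain ⟨c, hc⟩ := hu'
  simpa [hc] using h'.neg_sum_mem hP.2.2 hv' {c}

namespace IsVertexFrame

variable {n : ℕ} {P : Set (Fin n → ℝ)} {v : Fin n → ℝ} {u y : Fin n → Fin n → ℤ}

lemma mem_ewaldSet (h : IsVertexFrame P v u y) (hP : IsDeeplyMonotone P) (hv : IsVertex P v)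
    (i : Fin n) : u i ∈ ewaldSet P := by
  refine ⟨hP.latticeVec_mem (v := v) ?_, by simpa using h.neg_sum_mem hP.2.2 hv {i}⟩
  rw [← h.range_eq]
  exact ⟨i, rfl⟩

/-- Let `v'` be the other end of the edge along `u a`. The two-dimensional face spanned by `u a` and
`u b` at `v` is spanned at `v'` by `-u a` and `u b + k • u a` for some integer `k`. The two points
are the Ewald points at `v'` that result. -/
lemma exists_shear (h : IsVertexFrame P v u y) (hP : IsDeeplyMonotone P) (hv : IsVertex P v)
    {a b : Fin n} (hab : a ≠ b) :
    ∃ k : ℤ, latticeVec (u b) + (k : ℝ) • latticeVec (u a) ∈ P ∧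
      latticeVec (u a) - (latticeVec (u b) + (k : ℝ) • latticeVec (u a)) ∈ P := by
  have hua : u a ∈ primitiveEdgeVectors P v := h.range_eq ▸ Set.mem_range_self a
  obtain ⟨τ, hv', hu'⟩ :=
    exists_isVertex_neg_mem_primitiveEdgeVectors hP.1.smooth.polytope hua
  obtain ⟨u', y', h'⟩ := hP.1.exists_isVertexFrame hv'
  rw [← h'.range_eq] at hu'
  obtain ⟨c, hc⟩ := hu'
  have hex : ∀ i, i ≠ a → ∃ d, y' d = y i := fun i hi =>
    h.exists_normal_eq h' hP.2.2 hv hv' i <| by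
      rw [dotProduct_add, dotProduct_smul, h.real_dual, if_neg hi, smul_zero, add_zero]
  obtain ⟨d, hd⟩ := hex b hab.symm
  have hud : u' d = u b + (-(y a ⬝ᵥ u' d)) • u a := by
    refine h.int_ext fun i => ?_
    rw [dotProduct_add, dotProduct_smul, h.dual, h.dual, smul_eq_mul]
    by_cases hia : i = a
    · subst hia
      rw [if_neg hab, if_pos rfl]
      ring
    obtain ⟨j, hj⟩ := hex i hia
    rw [if_neg hia, mul_zero, add_zero, ← hj, h'.dual]
    have : j = d ↔ i = b := by
      constructor
      · rintro rfl
        by_contra hib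
        have h1 := h.dual i b
        rw [← hj, hd, h.dual, if_pos rfl, if_neg hib] at h1
        omega
      · rintro rfl
        by_contra hjd
        have h1 := h'.dual j d
        rw [hj, ← hd, h'.dual, if_pos rfl, if_neg hjd] at h1
        omega
    simp only [this]
  have hcd : c ≠ d := by
    rintro rfl
    have h1 := h'.dual c c
    rw [hd, hc, dotProduct_neg, h.dual, if_neg hab.symm, if_pos rfl] at h1
    omega
  have hud' := congrArg latticeVec hud
  rw [latticeVec_add, latticeVec_smul] at hud'
  refine ⟨-(y a ⬝ᵥ u' d), ?_, ?_⟩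
  · rw [← hud']
    exact (h'.mem_ewaldSet hP hv' d).1
  · have h1 := h'.neg_sum_mem hP.2.2 hv' {c, d}
    rw [Finset.sum_pair hcd, hc, latticeVec_neg] at h1
    rw [← hud']
    convert h1 using 1
    abel

lemma add_mem_or_sub_mem (h : IsVertexFrame P v u y) (hP : IsDeeplyMonotone P)
    (hv : IsVertex P v) {a b : Fin n} (hab : a ≠ b) :
    latticeVec (u a) + latticeVec (u b) ∈ P ∨ latticeVec (u a) - latticeVec (u b) ∈ P := by
  obtain ⟨k, hk₁, hk₂⟩ := h.exists_shear hP hv hab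
  have hconv := hP.1.smooth.polytope.convex
  have hb := (h.mem_ewaldSet hP hv b).1
  have hneg := h.neg_sum_mem hP.2.2 hv {a, b}
  rw [Finset.sum_pair hab] at hneg
  rcases le_or_gt 1 k with hk | hk
  · -- `u a + u b` lies between `u b` and `u b + k • u a`.
    left
    have hk' : (1 : ℝ) ≤ k := by exact_mod_cast hk
    have hk0 : (0 : ℝ) < k := by linarith
    convert hconv hb hk₁ (a := 1 - (k : ℝ)⁻¹) (b := (k : ℝ)⁻¹)
      (sub_nonneg.2 (inv_le_one_of_one_le₀ hk')) (inv_nonneg.2 hk0.le) (by ring) using 1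
    ext j
    simp only [Pi.add_apply, Pi.smul_apply, smul_eq_mul]
    field_simp
    ring
  · -- `u a - u b` lies between `-u a - u b` and `(1 - k) • u a - u b`.
    right
    have hk' : (k : ℝ) ≤ 0 := by exact_mod_cast Int.lt_add_one_iff.1 hk
    have hk0 : (0 : ℝ) < 2 - k := by linarith
    convert hconv hneg hk₂ (a := -k / (2 - k)) (b := 2 / (2 - k))
      (div_nonneg (by linarith) hk0.le) (div_nonneg zero_le_two hk0.le)
      (by field_simp; ring) using 1
    ext j
    simp only [Pi.add_apply, Pi.sub_apply, Pi.neg_apply, Pi.smul_apply, smul_eq_mul]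
    field_simp
    ring

lemma add_mem_ewaldSet_or_sub_mem_ewaldSet (h : IsVertexFrame P v u y)
    (hP : IsDeeplyMonotone P) (hv : IsVertex P v) (a b : Fin n) :
    u a + u b ∈ ewaldSet P ∨ u a - u b ∈ ewaldSet P := by
  by_cases hab : a = b
  · right
    have : (0 : Fin n → ℝ) ∈ P := interior_subset hP.2.2.zero_mem_interior
    simpa [hab, ewaldSet] using this
  have hneg := h.neg_sum_mem hP.2.2 hv {a, b}
  rw [Finset.sum_pair hab] at hneg
  rcases h.add_mem_or_sub_mem hP hv hab with h1 | h1
  · exact Or.inl ⟨by simpa using h1, by simpa [add_comm] using hneg⟩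
  rcases h.add_mem_or_sub_mem hP hv (Ne.symm hab) with h2 | h2
  · exact Or.inl ⟨by simpa [add_comm] using h2, by simpa [add_comm] using hneg⟩
  · exact Or.inr ⟨by simpa using h1, by simpa using h2⟩

/-! ### The Ewald conditions -/

/-- If `f` lies in the facet of normal `y i`, then `-u i` is a witness for the star Ewald condition:
among the facets through `v` it lies on this one only, and `u i` lies on none. -/
lemma isStarEwaldFace (h : IsVertexFrame P v u y) (hP : IsDeeplyMonotone P)
    (hv : IsVertex P v) {f : Set (Fin n → ℝ)} (hvf : v ∈ f) {i : Fin n}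
    (hi : f ⊆ {x | x ∈ P ∧ latticeVec (y i) ⬝ᵥ x = latticeVec (y i) ⬝ᵥ v}) :
    IsStarEwaldFace P f := by
  have hE := h.mem_ewaldSet hP hv i
  have hone := h.dotProduct_eq_one hP.2.2 hv
  refine ⟨-u i, neg_mem_ewaldSet hE, ⟨⟨_, h.isFacet i, hi, ?_⟩, ?_⟩, ?_⟩
  · refine ⟨(neg_mem_ewaldSet hE).1, ?_⟩
    rw [latticeVec_neg, dotProduct_neg, h.real_dual, if_pos rfl, hone, neg_neg]
  · rintro ⟨R, hR, hfR, hmem⟩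
    obtain ⟨J, hJ⟩ := h.exists_eq_of_isFace hR.1 (hfR hvf)
    have hcard := h.faceDim_add_card J
    rw [← hJ] at hcard
    obtain ⟨j, hj, hji⟩ := Finset.exists_mem_ne (s := J) (by have := hR.2; omega) i
    rw [hJ] at hmem
    have := hmem.2 j hj
    rw [latticeVec_neg, dotProduct_neg, h.real_dual, if_neg hji, hone] at this
    norm_num at this
  · rintro ⟨F, hF, hfF, hmem⟩
    obtain ⟨J, hJ⟩ := h.exists_eq_of_isFace hF.1 (hfF hvf)
    have hcard := h.faceDim_add_card J
    rw [← hJ] at hcard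
    obtain ⟨j, hj⟩ := Finset.card_pos.1 (show 0 < J.card by have := hF.2; omega)
    rw [hJ] at hmem
    have := hmem.2 j hj
    rw [latticeVec_neg, neg_neg, h.real_dual, hone] at this
    split_ifs at this <;> norm_num at this

/-- The Ewald points of the facet of normal `y i` contain a unimodular basis consisting of `-u i`
and, for each `j ≠ i`, one of `-u i - u j` and `-u i + u j`. -/
lemma exists_isUnimodularBasis (h : IsVertexFrame P v u y) (hP : IsDeeplyMonotone P)
    (hv : IsVertex P v) (i : Fin n) :
    ∃ B : Set (Fin n → ℤ), B ⊆ ewaldSet P ∧ (∀ z ∈ B, y i ⬝ᵥ z = 1) ∧ IsUnimodularBasis B := by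
  have hex : ∀ j, ∃ z ∈ ewaldSet P, y i ⬝ᵥ z = 1 ∧ (j = i → z = -u i) ∧
      (j ≠ i → z = -u i - u j ∨ z = -u i + u j) := by
    intro j
    by_cases hj : j = i
    · refine ⟨-u i, neg_mem_ewaldSet (h.mem_ewaldSet hP hv i), ?_, fun _ => rfl,
        fun hne => absurd hj hne⟩
      rw [dotProduct_neg, h.dual, if_pos rfl, neg_neg]
    · rcases h.add_mem_ewaldSet_or_sub_mem_ewaldSet hP hv i j with hE | hE
      · refine ⟨-u i - u j, by rw [← neg_add']; exact neg_mem_ewaldSet hE, ?_,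
          fun h' => absurd h' hj, fun _ => Or.inl rfl⟩
        rw [dotProduct_sub, dotProduct_neg, h.dual, h.dual, if_pos rfl, if_neg (Ne.symm hj)]
        norm_num
      · refine ⟨-u i + u j, by simpa [add_comm, sub_eq_add_neg] using neg_mem_ewaldSet hE, ?_,
          fun h' => absurd h' hj, fun _ => Or.inr rfl⟩
        rw [dotProduct_add, dotProduct_neg, h.dual, h.dual, if_pos rfl, if_neg (Ne.symm hj)]
        norm_num
  choose b hbE hby hbi hbj using hex
  have hmem : ∀ j, b j ∈ Submodule.span ℤ (Set.range b) := fun j => Submodule.subset_span ⟨j, rfl⟩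
  have hu : ∀ j, u j ∈ Submodule.span ℤ (Set.range b) := by
    intro j
    have hui : u i ∈ Submodule.span ℤ (Set.range b) := by
      rw [← neg_neg (u i), ← hbi i rfl]
      exact Submodule.neg_mem _ (hmem i)
    by_cases hj : j = i
    · rwa [hj]
    rcases hbj j hj with h1 | h1
    · rw [show u j = -u i - b j by rw [h1]; abel]
      exact Submodule.sub_mem _ (Submodule.neg_mem _ hui) (hmem j)
    · rw [show u j = u i + b j by rw [h1]; abel]
      exact Submodule.add_mem _ hui (hmem j)
  have hspan : Submodule.span ℤ (Set.range b) = ⊤ := by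
    rw [eq_top_iff]
    intro z _
    rw [eq_neg_sum_of_dual h.dual z]
    exact Submodule.neg_mem _ (Submodule.sum_mem _ fun j _ => Submodule.smul_mem _ _ (hu j))
  refine ⟨Set.range b, ?_, ?_, ?_, hspan⟩
  · rintro _ ⟨j, rfl⟩
    exact hbE j
  · rintro _ ⟨j, rfl⟩
    exact hby j
  · exact (linearIndependent_of_top_le_span_of_card_eq_finrank hspan.ge (by simp)).linearIndepOn_id

end IsVertexFrame

lemma IsDeeplyMonotone.starEwald {n : ℕ} {P : Set (Fin n → ℝ)} (hP : IsDeeplyMonotone P) :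
    StarEwald P := by
  intro f hf hfP
  obtain ⟨v, hvf, hv⟩ := hf.exists_isVertex hP.1.smooth.polytope
  obtain ⟨u, y, h⟩ := hP.1.exists_isVertexFrame hv
  obtain ⟨I, hI⟩ := h.exists_eq_of_isFace hf hvf
  rcases I.eq_empty_or_nonempty with rfl | ⟨i, hi⟩
  · simp at hI
    exact absurd hI hfP
  · refine h.isStarEwaldFace hP hv hvf (i := i) ?_
    rw [hI]
    exact fun x hx => ⟨hx.1, hx.2 i hi⟩

lemma IsDeeplyMonotone.strongEwald {n : ℕ} {P : Set (Fin n → ℝ)} (hP : IsDeeplyMonotone P) :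
    StrongEwald P := by
  intro F hF
  obtain ⟨v, hvF, hv⟩ := hF.1.exists_isVertex hP.1.smooth.polytope
  obtain ⟨u, y, h⟩ := hP.1.exists_isVertexFrame hv
  obtain ⟨I, hI⟩ := h.exists_eq_of_isFace hF.1 hvF
  have hcard := h.faceDim_add_card I
  rw [← hI] at hcard
  obtain ⟨i, rfl⟩ := Finset.card_eq_one.1 (show I.card = 1 by have := hF.2; omega)
  obtain ⟨B, hB, hBy, hbasis⟩ := h.exists_isUnimodularBasis hP hv i
  refine ⟨B, hB, fun z hz => ?_, hbasis⟩
  rw [hI]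
  refine ⟨(hB hz).1, fun j hj => ?_⟩
  rw [Finset.mem_singleton.1 hj, latticeVec_dotProduct, hBy z hz,
    h.dotProduct_eq_one hP.2.2 hv, Int.cast_one]

lemma IsDeeplyMonotone.primitiveEdgeVectors_subset {n : ℕ} {P : Set (Fin n → ℝ)}
    (hP : IsDeeplyMonotone P) {v : Fin n → ℝ} (hv : IsVertex P v) :
    primitiveEdgeVectors P v ⊆ ewaldSet P := by
  obtain ⟨u, y, h⟩ := hP.1.exists_isVertexFrame hv
  rw [← h.range_eq]
  rintro _ ⟨i, rfl⟩
  exact h.mem_ewaldSet hP hv i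

lemma IsDeeplyMonotone.weakEwald {n : ℕ} {P : Set (Fin n → ℝ)} (hP : IsDeeplyMonotone P) :
    WeakEwald P := by
  obtain ⟨v, -, hv⟩ := hP.1.smooth.polytope.exists_isVertex
    (hP.1.smooth.fullDim.mono interior_subset)
  exact ⟨_, hP.primitiveEdgeVectors_subset hv, hP.1.smooth.unimodular v hv⟩

theorem theorem4 (n : ℕ) (P : Set (Fin n → ℝ)) (hP : IsDeeplyMonotone P) :
    (∀ v, IsVertex P v →
      ∀ u₁ ∈ primitiveEdgeVectors P v, ∀ u₂ ∈ primitiveEdgeVectors P v,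
        u₁ ∈ ewaldSet P ∧ u₂ ∈ ewaldSet P ∧
          (u₁ + u₂ ∈ ewaldSet P ∨ u₁ - u₂ ∈ ewaldSet P)) ∧
    StarEwald P ∧ StrongEwald P ∧ WeakEwald P := by
  refine ⟨fun v hv u₁ hu₁ u₂ hu₂ => ?_, hP.starEwald, hP.strongEwald, hP.weakEwald⟩
  refine ⟨hP.primitiveEdgeVectors_subset hv hu₁, hP.primitiveEdgeVectors_subset hv hu₂, ?_⟩
  obtain ⟨u, y, h⟩ := hP.1.exists_isVertexFrame hv
  rw [← h.range_eq] at hu₁ hu₂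
  obtain ⟨a, rfl⟩ := hu₁
  obtain ⟨b, rfl⟩ := hu₂
  exact h.add_mem_ewaldSet_or_sub_mem_ewaldSet hP hv a b
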